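/- Let $n\ge 0$ be an integer, let $A\in\mathbb{R}^{n\times n}$ be symmetric positive definite, let $b\in\mathbb{R}^n$, and let $f(x)=\tfrac12 x^{T}Ax-b^{T}x$ be the corresponding strictly convex quadratic on $\mathbb{R}^n$. Let $(\tau_k)$ be any sequence of real numbers $\tau_k\ge 0$. Let $\{x_k\}_{k\ge 0}$ be generated by the regularized Barzilai–Borwein (RBB) method: starting from an arbitrary point $x_0\in\mathbb{R}^n$ and an arbitrary initial scalar $\alpha_0>0$, and writing $g_k=\nabla f(x_k)$, as long as $g_k\neq 0$ one sets $$x_{k+1}=x_k-\alpha_k^{-1}g_k ,\qquad k\ge 0,$$ where, for $k\ge 1$, $$\alpha_k=\frac{s_{k-1}^{T}y_{k-1}+\tau_k\,y_{k-1}^{T}y_{k-1}}{s_{k-1}^{T}s_{k-1}+\tau_k\,s_{k-1}^{T}y_{k-1}},\qquad s_{k-1}=x_k-x_{k-1},\quad y_{k-1}=g_k-g_{k-1}.$$ Then either $g_k=0$ for some finite $k$, or the sequence $\{\|g_k\|_2\}$ converges to zero $R$-linearly, that is, there are constants $C>0$ and $\theta\in(0,1)$ such that $\|g_k\|_2\le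 C\,\theta^{k}$ for all $k\ge 0$. -/

import Mathlib

/-- The quadratic `f(x) = (1/2) xᵀ A x - bᵀ x` on `ℝⁿ` with the Euclidean inner product. -/
noncomputable def quadObjective {n : ℕ} (A : Matrix (Fin n) (Fin n) ℝ)
    (b : EuclideanSpace ℝ (Fin n)) (x : EuclideanSpace ℝ (Fin n)) : ℝ :=
  (1 / 2) * inner ℝ x (Matrix.toEuclideanLin A x) - inner ℝ b x

/-- The regularized Barzilai-Borwein scalar
`(sᵀ y + τ yᵀ y) / (sᵀ s + τ sᵀ y)`. -/
noncomputable def rbbScalar {n : ℕ} (τ : ℝ) (s y : EuclideanSpace ℝ (Fin n)) : ℝ :=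
  (inner ℝ s y + τ * inner ℝ y y) / (inner ℝ s s + τ * inner ℝ s y)

/-- `x` is a sequence of iterates, with scalars `α` (inverse step sizes), generated by the
regularized Barzilai-Borwein method for `f` with regularization parameters `τ`. The initial scalar
`α 0` is an arbitrary positive number. The method stops at the first zero gradient, so that
nothing is required of the sequences from there on. -/
structure IsRBBSequence {n : ℕ} (f : EuclideanSpace ℝ (Fin n) → ℝ) (τ : ℕ → ℝ)
    (x : ℕ → EuclideanSpace ℝ (Fin n)) (α : ℕ → ℝ) : Prop where
  scalar_zero_pos : 0 < α 0
  scalar_succ : ∀ k, (∀ j ≤ k + 1, gradient f (x j) ≠ 0) →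
    α (k + 1) = rbbScalar (τ (k + 1)) (x (k + 1) - x k)
      (gradient f (x (k + 1)) - gradient f (x k))
  step : ∀ k, (∀ j ≤ k, gradient f (x j) ≠ 0) →
    x (k + 1) = x k - (α k)⁻¹ • gradient f (x k)

/-- R-linear convergence of a real sequence `u` to `l`: the error is dominated by a geometric
sequence with ratio in `(0, 1)`. -/
def RLinearlyConvergesTo (u : ℕ → ℝ) (l : ℝ) : Prop :=
  ∃ C θ : ℝ, 0 < C ∧ 0 < θ ∧ θ < 1 ∧ ∀ k, |u k - l| ≤ C * θ ^ k

/-! In an orthonormal eigenbasis of `A` with eigenvalues `μ j`, the gradient coordinate `u k j` is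
multiplied at each step by `1 - μ j / α k`, and `α (k + 1)` is the mean of the `μ j` with weights
`(1 + τ μ j) (u k j)²`.

The coordinates decay R-linearly, by strong induction on the eigenvalue. Fix `i` and let `S k` be
the sum of `(u k j)²` over `μ j < μ i`, which decays by induction. If `S k ≤ (u k i)² / 2`, then `α
(k + 1) ≥ 2/3 μ i` and the next step contracts coordinate `i` by a fixed factor
(`two_thirds_le_weighted_mean`, `sq_one_sub_div_le`). Otherwise `(u k i)² ≤ 2 S k` is already small
and grows boundedly over two steps. Either way the squares satisfy a contraction with an R-linearly
small error (`of_contraction_add`). -/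

/-! ### Closure properties of R-linear convergence to zero. -/

namespace RLinearlyConvergesTo

theorem zero : RLinearlyConvergesTo (fun _ => 0) 0 :=
  ⟨1, 1 / 2, by norm_num, by norm_num, by norm_num, fun k => by
    rw [sub_zero, abs_zero]; positivity⟩

theorem add {u v : ℕ → ℝ} (hu : RLinearlyConvergesTo u 0) (hv : RLinearlyConvergesTo v 0) :
    RLinearlyConvergesTo (fun k => u k + v k) 0 := by
  obtain ⟨C, θ, hC, h0, h1, hb⟩ := hu
  obtain ⟨D, φ, hD, h0', h1', hb'⟩ := hv
  refine ⟨C + D, max θ φ, by positivity, lt_max_of_lt_left h0, max_lt h1 h1', fun k => ?_⟩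
  have h2 := hb k
  have h3 := hb' k
  rw [sub_zero] at h2 h3 ⊢
  have h4 : θ ^ k ≤ max θ φ ^ k := by gcongr; exact le_max_left _ _
  have h5 : φ ^ k ≤ max θ φ ^ k := by gcongr; exact le_max_right _ _
  calc |u k + v k| ≤ |u k| + |v k| := abs_add_le _ _
    _ ≤ C * max θ φ ^ k + D * max θ φ ^ k := by
      gcongr
      · exact h2.trans (by gcongr)
      · exact h3.trans (by gcongr)
    _ = (C + D) * max θ φ ^ k := by ring

theorem const_mul {u : ℕ → ℝ} (a : ℝ) (hu : RLinearlyConvergesTo u 0) :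
    RLinearlyConvergesTo (fun k => a * u k) 0 := by
  obtain ⟨C, θ, hC, h0, h1, hb⟩ := hu
  refine ⟨(|a| + 1) * C, θ, by positivity, h0, h1, fun k => ?_⟩
  have h2 := hb k
  rw [sub_zero] at h2 ⊢
  rw [abs_mul, mul_assoc]
  gcongr
  linarith

theorem sum {ι : Type*} (s : Finset ι) {u : ι → ℕ → ℝ}
    (h : ∀ i ∈ s, RLinearlyConvergesTo (u i) 0) :
    RLinearlyConvergesTo (fun k => ∑ i ∈ s, u i k) 0 := by
  classical
  induction s using Finset.induction_on with
  | empty => simpa using zero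
  | insert i s hi ih =>
    simp only [Finset.sum_insert hi]
    exact (h i (Finset.mem_insert_self i s)).add
      (ih fun j hj => h j (Finset.mem_insert_of_mem hj))

theorem of_shift {u : ℕ → ℝ} (h : RLinearlyConvergesTo (fun k => u (k + 1)) 0) :
    RLinearlyConvergesTo u 0 := by
  obtain ⟨C, θ, hC, h0, h1, hb⟩ := h
  refine ⟨|u 0| + C / θ, θ, by positivity, h0, h1, fun k => ?_⟩
  rw [sub_zero]
  cases k with
  | zero =>
    have : 0 < C / θ := by positivity
    simp only [pow_zero, mul_one]
    linarith
  | succ k =>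
    have h2 := hb k
    rw [sub_zero] at h2
    have h3 : (|u 0| + C / θ) * θ ^ (k + 1) = |u 0| * θ ^ (k + 1) + C * θ ^ k := by
      field_simp
      ring
    have h4 : 0 ≤ |u 0| * θ ^ (k + 1) := by positivity
    linarith

theorem of_contraction_add {v e : ℕ → ℝ} {c : ℝ} (hv : ∀ k, 0 ≤ v k) (hc0 : 0 ≤ c) (hc : c < 1)
    (he : RLinearlyConvergesTo e 0) (h : ∀ k, v (k + 1) ≤ c * v k + e k) :
    RLinearlyConvergesTo v 0 := by
  obtain ⟨C, θ, hC, h0, h1, hb⟩ := he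
  -- The rate `φ` strictly exceeds `c`, so that a constant at least `C / (φ - c)` absorbs the error
  -- at each step.
  obtain ⟨φ, hφ, hφ1⟩ := exists_between (max_lt hc h1)
  have hcφ : 0 < φ - c := sub_pos.2 ((le_max_left _ _).trans_lt hφ)
  have hθφ : θ ≤ φ := ((le_max_right _ _).trans_lt hφ).le
  have hφ0 : 0 < φ := h0.trans_le hθφ
  have hD : 0 < v 0 + C / (φ - c) := add_pos_of_nonneg_of_pos (hv 0) (by positivity)
  refine ⟨v 0 + C / (φ - c), φ, hD, hφ0, hφ1, fun k => ?_⟩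
  rw [sub_zero, abs_of_nonneg (hv k)]
  induction k with
  | zero =>
    have : 0 < C / (φ - c) := by positivity
    simp only [pow_zero, mul_one]
    linarith
  | succ k ih =>
    have h2 := hb k
    rw [sub_zero] at h2
    have h3 : C ≤ (v 0 + C / (φ - c)) * (φ - c) := by
      rw [add_mul, div_mul_cancel₀ _ hcφ.ne']
      linarith [mul_nonneg (hv 0) hcφ.le]
    calc v (k + 1) ≤ c * v k + e k := h k
      _ ≤ c * ((v 0 + C / (φ - c)) * φ ^ k) + (v 0 + C / (φ - c)) * (φ - c) * φ ^ k := by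
        gcongr
        calc e k ≤ C * θ ^ k := (le_abs_self _).trans h2
          _ ≤ _ := by gcongr
      _ = (v 0 + C / (φ - c)) * φ ^ (k + 1) := by ring

theorem of_sq {u : ℕ → ℝ} (h : RLinearlyConvergesTo (fun k => u k ^ 2) 0) :
    RLinearlyConvergesTo u 0 := by
  obtain ⟨C, θ, hC, h0, h1, hb⟩ := h
  refine ⟨√C, √θ, Real.sqrt_pos.2 hC, Real.sqrt_pos.2 h0,
    (Real.sqrt_lt' one_pos).2 (by simpa using h1), fun k => ?_⟩
  have h2 := hb k
  rw [sub_zero] at h2 ⊢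
  refine abs_le_of_sq_le_sq ?_ (by positivity)
  rw [mul_pow, ← pow_mul, mul_comm k 2, pow_mul, Real.sq_sqrt hC.le, Real.sq_sqrt h0.le]
  exact (le_abs_self _).trans h2

end RLinearlyConvergesTo

/-! ### Decay of the spectral coordinates. -/

section Spectral

variable {ι : Type*} [Fintype ι]

/-- A weighted mean of the `μ j` is at least `2 / 3` of `μ i`, if the weights of the smaller
`μ j` add up to at most half the weight of `μ i`. -/
theorem two_thirds_le_weighted_mean {μ w : ι → ℝ} {a : ℝ} (hμ : ∀ j, 0 < μ j) (hw : ∀ j, 0 ≤ w j)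
    (hpos : 0 < ∑ j, w j) (ha : a * ∑ j, w j = ∑ j, μ j * w j) (i : ι)
    (hi : ∑ j with μ j < μ i, w j ≤ w i / 2) : 2 / 3 * μ i ≤ a := by
  have hsplit := Finset.sum_filter_add_sum_filter_not Finset.univ (fun j => μ j < μ i) w
  have hwi : w i ≤ ∑ j with ¬ μ j < μ i, w j :=
    Finset.single_le_sum (fun j _ => hw j) (by simp)
  have h1 : μ i * ∑ j with ¬ μ j < μ i, w j ≤ ∑ j, μ j * w j := by
    rw [Finset.mul_sum]
    calc _ ≤ ∑ j with ¬ μ j < μ i, μ j * w j :=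
          Finset.sum_le_sum fun j hj => mul_le_mul_of_nonneg_right
            (not_lt.1 (Finset.mem_filter.1 hj).2) (hw j)
      _ ≤ _ := Finset.sum_le_sum_of_subset_of_nonneg (Finset.filter_subset _ _)
          fun j _ _ => mul_nonneg (hμ j).le (hw j)
  have h2 : 2 / 3 * ∑ j, w j ≤ ∑ j with ¬ μ j < μ i, w j := by linarith
  refine le_of_mul_le_mul_right ?_ hpos
  calc 2 / 3 * μ i * ∑ j, w j = μ i * (2 / 3 * ∑ j, w j) := by ring
    _ ≤ μ i * ∑ j with ¬ μ j < μ i, w j := mul_le_mul_of_nonneg_left h2 (hμ i).le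
    _ ≤ _ := by rw [ha]; exact h1

/-- The ratio `t / a` lies in `[t / L, 3 / 2]`, so `1 - t / a` lies in `[-1 / 2, 1 - t / L]`. -/
theorem sq_one_sub_div_le {t a L : ℝ} (ht : 0 < t) (ha : 2 / 3 * t ≤ a)
    (haL : a ≤ L) : (1 - t / a) ^ 2 ≤ max (1 / 2) (1 - t / L) ^ 2 := by
  have ha0 : 0 < a := by linarith
  have h1 : t / L ≤ t / a := by gcongr
  have h2 : t / a ≤ 3 / 2 := by rw [div_le_iff₀ ha0]; linarith
  refine sq_le_sq' ?_ ?_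
  · linarith [le_max_left (1 / 2) (1 - t / L)]
  · linarith [le_max_right (1 / 2) (1 - t / L)]

/-- Gradient descent in spectral coordinates, where the inverse step sizes are means of the
eigenvalues `μ j` with weights `(1 + τ μ j) (u j)²` taken from the preceding iterate. -/
theorem rLinearlyConvergesTo_spectral_sq {μ : ι → ℝ} (hμ : ∀ j, 0 < μ j) {τ α : ℕ → ℝ}
    (hτ : ∀ k, 0 ≤ τ k) {u : ℕ → ι → ℝ} (hu : ∀ k, 0 < ∑ j, u k j ^ 2) (hα : 0 < α 0)
    (hstep : ∀ k j, u (k + 1) j = (1 - μ j / α k) * u k j)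
    (hmean : ∀ k, α (k + 1) * ∑ j, (1 + τ (k + 1) * μ j) * u k j ^ 2 =
      ∑ j, μ j * ((1 + τ (k + 1) * μ j) * u k j ^ 2)) (i : ι) :
    RLinearlyConvergesTo (fun k => u k i ^ 2) 0 := by
  have hι : (Finset.univ : Finset ι).Nonempty := ⟨i, Finset.mem_univ i⟩
  obtain ⟨p, -, hp⟩ := Finset.exists_min_image Finset.univ μ hι
  obtain ⟨q, -, hq⟩ := Finset.exists_max_image Finset.univ μ hι
  have hτμ : ∀ k j, 0 ≤ τ k * μ j := fun k j => mul_nonneg (hτ k) (hμ j).le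
  have hw : ∀ k j, 0 ≤ (1 + τ (k + 1) * μ j) * u k j ^ 2 := fun k j =>
    mul_nonneg (by linarith [hτμ (k + 1) j]) (sq_nonneg _)
  have hwpos : ∀ k, 0 < ∑ j, (1 + τ (k + 1) * μ j) * u k j ^ 2 := fun k =>
    (hu k).trans_le <| Finset.sum_le_sum fun j _ =>
      le_mul_of_one_le_left (sq_nonneg _) (by linarith [hτμ (k + 1) j])
  have hlow : ∀ k, μ p ≤ α (k + 1) := fun k => by
    refine le_of_mul_le_mul_right ?_ (hwpos k)
    rw [hmean, Finset.mul_sum]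
    exact Finset.sum_le_sum fun j _ =>
      mul_le_mul_of_nonneg_right (hp j (Finset.mem_univ j)) (hw k j)
  have hupp : ∀ k, α (k + 1) ≤ μ q := fun k => by
    refine le_of_mul_le_mul_right ?_ (hwpos k)
    rw [hmean, Finset.mul_sum]
    exact Finset.sum_le_sum fun j _ =>
      mul_le_mul_of_nonneg_right (hq j (Finset.mem_univ j)) (hw k j)
  obtain ⟨m, hm0, hm⟩ : ∃ m, 0 < m ∧ ∀ k, m ≤ α k := by
    refine ⟨min (α 0) (μ p), lt_min hα (hμ p), fun k => ?_⟩
    cases k with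
    | zero => exact min_le_left _ _
    | succ k => exact (min_le_right _ _).trans (hlow k)
  -- Induction along strict inequality of eigenvalues: repeated eigenvalues do not enter each
  -- other's error terms.
  have hwf : WellFounded (InvImage (· < ·) μ : ι → ι → Prop) :=
    Finite.wellFounded_of_trans_of_irrefl _
  induction i using hwf.induction with
  | _ i ih =>
  set K : ℝ := (1 + μ i / m) ^ 2 with hK
  have hK0 : 0 ≤ K := sq_nonneg _
  have hgrow : ∀ k, u (k + 1) i ^ 2 ≤ K * u k i ^ 2 := fun k => by
    rw [hstep, mul_pow]
    refine mul_le_mul_of_nonneg_right (sq_le_sq' ?_ ?_) (sq_nonneg _)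
    · have : μ i / α k ≤ μ i / m := by
        have := hm k
        have := (hμ i).le
        gcongr
      linarith
    · have h1 : 0 < μ i / α k := div_pos (hμ i) (hm0.trans_le (hm k))
      have h2 : 0 < μ i / m := div_pos (hμ i) hm0
      linarith
  have hS := RLinearlyConvergesTo.sum ({j | μ j < μ i} : Finset ι) (u := fun j k => u k j ^ 2)
    fun j hj => ih j (Finset.mem_filter.1 hj).2
  set c : ℝ := max (1 / 2) (1 - μ i / μ q) with hc
  have hc0 : 0 ≤ c := le_max_of_le_left (by norm_num)
  have hc1 : c < 1 := max_lt (by norm_num) (by linarith [div_pos (hμ i) (hμ q)])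
  -- The shift is needed because `α 0` is arbitrary: only `α (k + 1)` is a mean, governed by the
  -- coordinates at step `k`.
  refine .of_shift (.of_contraction_add (c := c ^ 2) (fun k => sq_nonneg _) (sq_nonneg _)
    (by nlinarith) (hS.const_mul (K * K * 2)) fun k => ?_)
  have hS0 : 0 ≤ ∑ j with μ j < μ i, u k j ^ 2 := Finset.sum_nonneg fun j _ => sq_nonneg _
  rcases le_total (∑ j with μ j < μ i, u k j ^ 2) (u k i ^ 2 / 2) with h | h
  · have hα' : 2 / 3 * μ i ≤ α (k + 1) := by
      refine two_thirds_le_weighted_mean hμ (hw k) (hwpos k) (hmean k) i ?_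
      -- The factor `1 + τ μ j` is nondecreasing in `μ j`, so regularization only favours the larger
      -- eigenvalues and `h` carries over to the weights.
      calc ∑ j with μ j < μ i, (1 + τ (k + 1) * μ j) * u k j ^ 2
          ≤ ∑ j with μ j < μ i, (1 + τ (k + 1) * μ i) * u k j ^ 2 := by
            refine Finset.sum_le_sum fun j hj => mul_le_mul_of_nonneg_right ?_ (sq_nonneg _)
            have := mul_le_mul_of_nonneg_left (Finset.mem_filter.1 hj).2.le (hτ (k + 1))
            linarith
        _ = (1 + τ (k + 1) * μ i) * ∑ j with μ j < μ i, u k j ^ 2 := by rw [Finset.mul_sum]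
        _ ≤ (1 + τ (k + 1) * μ i) * (u k i ^ 2 / 2) :=
            mul_le_mul_of_nonneg_left h (by linarith [hτμ (k + 1) i])
        _ = _ := by ring
    have h2 : u (k + 1 + 1) i ^ 2 ≤ c ^ 2 * u (k + 1) i ^ 2 := by
      rw [hstep (k + 1), mul_pow]
      exact mul_le_mul_of_nonneg_right
        (sq_one_sub_div_le (hμ i) hα' (hupp k)) (sq_nonneg _)
    have h3 : 0 ≤ K * K * 2 * ∑ j with μ j < μ i, u k j ^ 2 := by positivity
    linarith
  · have h1 : u (k + 1 + 1) i ^ 2 ≤ K * (K * u k i ^ 2) :=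
      (hgrow (k + 1)).trans (mul_le_mul_of_nonneg_left (hgrow k) hK0)
    have h2 : K * K * u k i ^ 2 ≤ K * K * (2 * ∑ j with μ j < μ i, u k j ^ 2) :=
      mul_le_mul_of_nonneg_left (by linarith) (by positivity)
    have h3 : 0 ≤ c ^ 2 * u (k + 1) i ^ 2 := by positivity
    linarith

end Spectral

/-! ### Passage from the RBB iteration to spectral coordinates. -/

theorem gradient_quadObjective {n : ℕ} {A : Matrix (Fin n) (Fin n) ℝ} (hA : A.IsHermitian)
    (b x : EuclideanSpace ℝ (Fin n)) :
    gradient (quadObjective A b) x = Matrix.toEuclideanLin A x - b := by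
  have hsymm : (Matrix.toEuclideanLin A).IsSymmetric := Matrix.isSymmetric_toEuclideanLin_iff.2 hA
  set T := (Matrix.toEuclideanLin A).toContinuousLinearMap with hT
  have h1 : HasFDerivAt (quadObjective A b) _ x :=
    (((hasFDerivAt_id x).inner ℝ (T.hasFDerivAt (x := x))).const_mul (1 / 2)).sub
      (innerSL ℝ b).hasFDerivAt
  refine HasGradientAt.gradient ?_
  rw [hasGradientAt_iff_hasFDerivAt]
  refine h1.congr_fderiv ?_
  ext v
  have h2 : inner ℝ x (Matrix.toEuclideanLin A v) = inner ℝ (Matrix.toEuclideanLin A x) v :=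
    (hsymm x v).symm
  simp [hT, h2, real_inner_comm]
  ring

theorem inner_eigenvectorBasis_toEuclideanLin {n : ℕ} {A : Matrix (Fin n) (Fin n) ℝ}
    (hA : A.IsHermitian) (i : Fin n) (v : EuclideanSpace ℝ (Fin n)) :
    inner ℝ (hA.eigenvectorBasis i) (Matrix.toEuclideanLin A v) =
      hA.eigenvalues i * inner ℝ (hA.eigenvectorBasis i) v := by
  have hsymm : (Matrix.toEuclideanLin A).IsSymmetric := Matrix.isSymmetric_toEuclideanLin_iff.2 hA
  have h : Matrix.toEuclideanLin A (hA.eigenvectorBasis i) =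
      hA.eigenvalues i • hA.eigenvectorBasis i := by
    ext j
    simpa using congrFun (hA.mulVec_eigenvectorBasis i) j
  rw [← hsymm, h, real_inner_smul_left]

/-- With `s = a • g` and `y = A s`, numerator and denominator are both `a ^ 2` times a spectral sum,
so the step length cancels. -/
theorem rbbScalar_mul_sum {n : ℕ} {A : Matrix (Fin n) (Fin n) ℝ} (hA : A.PosDef) {τ : ℝ}
    (hτ : 0 ≤ τ) {a : ℝ} (ha : a ≠ 0) {g : EuclideanSpace ℝ (Fin n)} (hg : g ≠ 0) :
    rbbScalar τ (a • g) (Matrix.toEuclideanLin A (a • g)) *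
        ∑ j, (1 + τ * hA.1.eigenvalues j) * inner ℝ (hA.1.eigenvectorBasis j) g ^ 2 =
      ∑ j, hA.1.eigenvalues j *
        ((1 + τ * hA.1.eigenvalues j) * inner ℝ (hA.1.eigenvectorBasis j) g ^ 2) := by
  have hsum : ∀ v w : EuclideanSpace ℝ (Fin n), inner ℝ v w =
      ∑ j, inner ℝ (hA.1.eigenvectorBasis j) v * inner ℝ (hA.1.eigenvectorBasis j) w := fun v w => by
    rw [← hA.1.eigenvectorBasis.sum_inner_mul_inner v w]
    simp only [real_inner_comm]
  have hgg : 0 < ∑ j, inner ℝ (hA.1.eigenvectorBasis j) g ^ 2 := by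
    have := real_inner_self_pos.2 hg
    rw [hsum] at this
    simpa only [pow_two] using this
  have hpos : 0 < ∑ j, (1 + τ * hA.1.eigenvalues j) * inner ℝ (hA.1.eigenvectorBasis j) g ^ 2 :=
    hgg.trans_le <| Finset.sum_le_sum fun j _ => le_mul_of_one_le_left (sq_nonneg _)
      (by linarith [mul_nonneg hτ (hA.eigenvalues_pos j).le])
  have hden : inner ℝ (a • g) (a • g) + τ * inner ℝ (a • g) (Matrix.toEuclideanLin A (a • g)) =
      a ^ 2 * ∑ j, (1 + τ * hA.1.eigenvalues j) * inner ℝ (hA.1.eigenvectorBasis j) g ^ 2 := by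
    simp only [hsum (a • g), inner_eigenvectorBasis_toEuclideanLin, real_inner_smul_right,
      Finset.mul_sum, ← Finset.sum_add_distrib]
    exact Finset.sum_congr rfl fun j _ => by ring
  have hnum : inner ℝ (a • g) (Matrix.toEuclideanLin A (a • g)) +
      τ * inner ℝ (Matrix.toEuclideanLin A (a • g)) (Matrix.toEuclideanLin A (a • g)) =
      a ^ 2 * ∑ j, hA.1.eigenvalues j *
        ((1 + τ * hA.1.eigenvalues j) * inner ℝ (hA.1.eigenvectorBasis j) g ^ 2) := by
    simp only [hsum (a • g), hsum (Matrix.toEuclideanLin A (a • g)),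
      inner_eigenvectorBasis_toEuclideanLin, real_inner_smul_right,
      Finset.mul_sum, ← Finset.sum_add_distrib]
    exact Finset.sum_congr rfl fun j _ => by ring
  rw [rbbScalar, hden, hnum, mul_div_mul_left _ _ (pow_ne_zero 2 ha), div_mul_cancel₀ _ hpos.ne']

theorem mainTheorem1 {n : ℕ} (A : Matrix (Fin n) (Fin n) ℝ) (hA : A.PosDef)
    (b : EuclideanSpace ℝ (Fin n)) (τ : ℕ → ℝ) (hτ : ∀ k, 0 ≤ τ k)
    (x : ℕ → EuclideanSpace ℝ (Fin n)) (α : ℕ → ℝ)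
    (hx : IsRBBSequence (quadObjective A b) τ x α) :
    (∃ k, gradient (quadObjective A b) (x k) = 0) ∨
      RLinearlyConvergesTo (fun k => ‖gradient (quadObjective A b) (x k)‖) 0 := by
  rw [or_iff_not_imp_left]
  intro hne
  push Not at hne
  obtain ⟨h0, hα, hstep⟩ := hx
  replace hα := fun k => hα k fun j _ => hne j
  replace hstep := fun k => hstep k fun j _ => hne j
  simp only [gradient_quadObjective hA.1] at *
  set g : ℕ → EuclideanSpace ℝ (Fin n) := fun k => Matrix.toEuclideanLin A (x k) - b with hg
  have hs : ∀ k, x (k + 1) - x k = (-(α k)⁻¹) • g k := fun k => by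
    rw [hstep, neg_smul]; abel
  have hy : ∀ k, g (k + 1) - g k = Matrix.toEuclideanLin A ((-(α k)⁻¹) • g k) := fun k => by
    rw [← hs, map_sub]
    exact sub_sub_sub_cancel_right _ _ _
  have hnorm : ∀ k, ∑ j, inner ℝ (hA.1.eigenvectorBasis j) (g k) ^ 2 = ‖g k‖ ^ 2 := fun k => by
    simpa using hA.1.eigenvectorBasis.sum_sq_norm_inner_right (g k)
  have hmean : ∀ k, α k ≠ 0 → α (k + 1) *
      ∑ j, (1 + τ (k + 1) * hA.1.eigenvalues j) * inner ℝ (hA.1.eigenvectorBasis j) (g k) ^ 2 =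
      ∑ j, hA.1.eigenvalues j * ((1 + τ (k + 1) * hA.1.eigenvalues j) *
        inner ℝ (hA.1.eigenvectorBasis j) (g k) ^ 2) := fun k hk => by
    have h1 := hα k
    rw [show Matrix.toEuclideanLin A (x (k + 1)) - b - (Matrix.toEuclideanLin A (x k) - b) =
      g (k + 1) - g k from rfl, hy, hs] at h1
    rw [h1]
    exact rbbScalar_mul_sum hA (hτ _) (neg_ne_zero.2 (inv_ne_zero hk)) (hne k)
  -- The mean formula for `α (k + 1)` requires `α k ≠ 0`, hence the induction.
  have hpos : ∀ k, 0 < α k := fun k => by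
    induction k with
    | zero => exact h0
    | succ k ih =>
      have hgk : 0 < ∑ j, inner ℝ (hA.1.eigenvectorBasis j) (g k) ^ 2 := by
        rw [hnorm]; exact pow_pos (norm_pos_iff.2 (hne k)) 2
      have hτμ : ∀ j, 0 ≤ τ (k + 1) * hA.1.eigenvalues j := fun j =>
        mul_nonneg (hτ _) (hA.eigenvalues_pos j).le
      obtain ⟨j, -, hj⟩ := Finset.exists_ne_zero_of_sum_ne_zero hgk.ne'
      have hw : 0 ≤ ∑ j, (1 + τ (k + 1) * hA.1.eigenvalues j) *
          inner ℝ (hA.1.eigenvectorBasis j) (g k) ^ 2 := Finset.sum_nonneg fun j _ =>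
        mul_nonneg (add_nonneg zero_le_one (hτμ j)) (sq_nonneg _)
      by_contra hle
      refine (mul_nonpos_of_nonpos_of_nonneg (not_lt.1 hle) hw).not_gt ?_
      rw [hmean k ih.ne']
      refine Finset.sum_pos' (fun j _ => mul_nonneg (hA.eigenvalues_pos j).le
        (mul_nonneg (add_nonneg zero_le_one (hτμ j)) (sq_nonneg _))) ⟨j, Finset.mem_univ j, ?_⟩
      exact mul_pos (hA.eigenvalues_pos j) (mul_pos (add_pos_of_pos_of_nonneg one_pos (hτμ j))
        ((sq_nonneg _).lt_of_ne' hj))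
  refine .of_sq ?_
  change RLinearlyConvergesTo (fun k => ‖g k‖ ^ 2) 0
  simp only [← hnorm]
  refine .sum _ fun i _ => rLinearlyConvergesTo_spectral_sq (hA.eigenvalues_pos) hτ
    (u := fun k j => inner ℝ (hA.1.eigenvectorBasis j) (g k)) (fun k => ?_) h0 (fun k j => ?_)
    (fun k => hmean k (hpos k).ne') i
  · rw [hnorm]; exact pow_pos (norm_pos_iff.2 (hne k)) 2
  · rw [← sub_add_cancel (g (k + 1)) (g k), hy, inner_add_right,
      inner_eigenvectorBasis_toEuclideanLin, real_inner_smul_right]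
    ring
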